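/- Words are over the alphabet $\{0,1\}$, and $[u,v]$ denotes the morphism of words with $0\mapsto u$, $1\mapsto v$. Let ${\bf d}=0100010101000100\cdots=\lim_{n\to\infty}\delta^n(0)$ be the period-doubling word, where $\delta=[01,00]$, and let $h_1=[0,01]$, $h_2=[0,10]$. A factor of ${\bf d}$ is a finite block of consecutive letters of ${\bf d}$, the empty word included. The word ${\bf d}$ encounters the binary pattern $p\in\{0,1\}^*$ if there are non-empty words $X,Y\in\{0,1\}^*$ such that $g(p)$ is a factor of ${\bf d}$, where $g=[X,Y]$. For $i=1,2$, a word $p$ is called a factor of $h_i^{-1}({\bf d})$ if $p$ is a factor of some finite word $u\in\{0,1\}^*$ such that $h_i(u)$ is a factor of ${\bf d}$ (equivalently, if $h_i(p)$ is a factor of ${\bf d}$). The complement $\overline{p}$ of $p$ is obtained by exchanging the letters $0$ and $1$. **Theorem.** A word $p\in\{0,1\}^*$ is a binary pattern encountered by ${\bf d}$ if and only if one of the following holds: 1. At least one of $p$ and $\overline{p}$ is a factor of ${\bf d}$, of $h_1^{-1}({\bf d})$ or of $h_2^{-1}({\bf d})$. 2. One of $p$ and $\overline{p}$ is among the ten words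 $0010100$, $01001001000$, $00100100100$, $001001001000$, $00010010010$, $000100100100$, $0010001000100$, $00100010001000$, $00010001000100$, $000100010001000$. The two possibilities are mutually exclusive: no word $p$ satisfies both 1 and 2. -/

import Mathlib

namespace PeriodDoubling

/-- Finite binary words. -/
abbrev Word := List (Fin 2)

/-- One-sided infinite binary words. -/
abbrev InfWord := ℕ → Fin 2

/-- The image of a finite word under the morphism determined by its values on the letters. -/
def applyMorphism (g : Fin 2 → Word) (u : Word) : Word := u.flatMap g

/-- The complement of a word: exchange the letters `0` and `1`. -/
def complement (u : Word) : Word := u.map (fun a => 1 - a)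

/-- `u` is a (finite, contiguous) factor of the infinite word `w`: it is read off `w` from
some position `i`. -/
def IsFactor (u : Word) (w : InfWord) : Prop :=
  ∃ i : ℕ, u = (List.range u.length).map (fun j => w (i + j))

/-- `w` encounters the binary pattern `p`: some non-erasing morphism maps `p` to a factor
of `w`. -/
def Encounters (w : InfWord) (p : Word) : Prop :=
  ∃ g : Fin 2 → Word, (∀ a, g a ≠ []) ∧ IsFactor (applyMorphism g p) w

/-- `p` is a factor of `h⁻¹(w)`, i.e. of some finite word whose image under `h` is a factor
of `w`. -/
def IsFactorOfInverseImage (p : Word) (h : Fin 2 → Word) (w : InfWord) : Prop :=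
  ∃ u : Word, p <:+: u ∧ IsFactor (applyMorphism h u) w

/-- The period-doubling morphism `[01, 00]`. -/
def delta : Fin 2 → Word := ![[0, 1], [0, 0]]

/-- The morphism `[0, 01]`. -/
def h₁ : Fin 2 → Word := ![[0], [0, 1]]

/-- The morphism `[0, 10]`. -/
def h₂ : Fin 2 → Word := ![[0], [1, 0]]

/-- The word `δⁿ(0)`. -/
def deltaIter (n : ℕ) : Word := (applyMorphism delta)^[n] [0]

/-- The period-doubling word, the limit of the words `δⁿ(0)`; its `n`-th letter is already the
`n`-th letter of `δⁿ(0)`, a word of length `2 ^ n > n`. -/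
def d : InfWord := fun n => (deltaIter n).getD n 0

/-- The ten sporadic patterns. -/
def sporadic : List Word :=
  [[0, 0, 1, 0, 1, 0, 0],
   [0, 1, 0, 0, 1, 0, 0, 1, 0, 0, 0],
   [0, 0, 1, 0, 0, 1, 0, 0, 1, 0, 0],
   [0, 0, 1, 0, 0, 1, 0, 0, 1, 0, 0, 0],
   [0, 0, 0, 1, 0, 0, 1, 0, 0, 1, 0],
   [0, 0, 0, 1, 0, 0, 1, 0, 0, 1, 0, 0],
   [0, 0, 1, 0, 0, 0, 1, 0, 0, 0, 1, 0, 0],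
   [0, 0, 1, 0, 0, 0, 1, 0, 0, 0, 1, 0, 0, 0],
   [0, 0, 0, 1, 0, 0, 0, 1, 0, 0, 0, 1, 0, 0],
   [0, 0, 0, 1, 0, 0, 0, 1, 0, 0, 0, 1, 0, 0, 0]]

/-- `q` is a factor of `d`, of `h₁⁻¹(d)` or of `h₂⁻¹(d)`. -/
def IsRegular (q : Word) : Prop :=
  IsFactor q d ∨ IsFactorOfInverseImage q h₁ d ∨ IsFactorOfInverseImage q h₂ d

theorem length_applyMorphism_delta (u : Word) :
    (applyMorphism delta u).length = 2 * u.length := by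
  induction u with
  | nil => rfl
  | cons a u ih =>
    have h : (delta a).length = 2 := by fin_cases a <;> rfl
    simp only [applyMorphism, List.flatMap_cons, List.length_append, List.length_cons] at ih ⊢
    omega

theorem deltaIter_succ (n : ℕ) : deltaIter (n + 1) = applyMorphism delta (deltaIter n) :=
  Function.iterate_succ_apply' _ _ _

theorem length_deltaIter (n : ℕ) : (deltaIter n).length = 2 ^ n := by
  induction n with
  | zero => rfl
  | succ n ih => rw [deltaIter_succ, length_applyMorphism_delta, ih, pow_succ, mul_comm]

theorem deltaIter_prefix_succ (n : ℕ) : deltaIter n <+: deltaIter (n + 1) := by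
  induction n with
  | zero => exact ⟨[1], rfl⟩
  | succ n ih =>
    obtain ⟨t, ht⟩ := ih
    refine ⟨applyMorphism delta t, ?_⟩
    calc deltaIter (n + 1) ++ applyMorphism delta t
        = applyMorphism delta (deltaIter n ++ t) := by
          rw [deltaIter_succ n]; simp [applyMorphism]
      _ = deltaIter (n + 1 + 1) := by rw [ht, ← deltaIter_succ]

theorem deltaIter_prefix {m n : ℕ} (h : m ≤ n) : deltaIter m <+: deltaIter n := by
  induction n, h using Nat.le_induction with
  | base => exact List.prefix_rfl
  | succ n _ ih => exact ih.trans (deltaIter_prefix_succ n)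

/-- Every `δⁿ(0)` is a prefix of `d`. -/
theorem deltaIter_eq_prefix_d (n : ℕ) : deltaIter n = (List.range (2 ^ n)).map d := by
  apply List.ext_getElem
  · simp [length_deltaIter]
  · intro i h1 h2
    have hi : i < (deltaIter i).length := by
      rw [length_deltaIter]; exact Nat.lt_two_pow_self
    have hd : d i = (deltaIter i)[i] := List.getD_eq_getElem _ _ hi
    simp only [List.getElem_map, List.getElem_range, hd]
    rcases le_total n i with h | h
    · exact (deltaIter_prefix h).getElem h1
    · exact ((deltaIter_prefix h).getElem hi).symm

end PeriodDoubling

namespace PeriodDoubling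

/-! ### The letters of the period-doubling word -/

/-! Everything follows from `d_even` and `d_odd`: even positions carry 0, odd positions carry the
complemented word. Hence all ones sit at odd positions, 0000 never occurs, and a period of the odd
positions halves, so there are no fourth powers.

Let g(p) occur in the word. If both images of letters have even length, keeping the positions of one
parity and complementing yields a shorter morphism for the same p, so induction on |g(0)| + |g(1)|
leaves the case of an odd length. If both images contain 1, two occurrences of the same image lie at
an even distance, which forbids almost every p (`isClassified_of_one_mem`). If only g(1) contains 1,
write it as 0^a u 0^b with u delimited by ones, and g(0) = 0^c. Successive copies of u are then 1 or
3 zeros apart (`IsDelimited.gap`). If both gaps arise, u = 1 (`IsDelimited.eq_singleton`) and g is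
the identity, `h₁` or `h₂`. If the gap is constant, few p survive (`isClassified_of_gap`); the
sporadic words come from such morphisms. Each of these finite cases is closed by listing forbidden
factors and searching the words that avoid them.

Exclusivity is a finite check, since every short factor lies in an iterate of δ on a two-letter
factor (`Occurs.infix_delta_iterate`). -/

theorem getElem?_applyMorphism_delta (u : Word) (n : ℕ) :
    (applyMorphism delta u)[2 * n]? = u[n]?.map (fun _ => 0) ∧
      (applyMorphism delta u)[2 * n + 1]? = u[n]?.map (fun a => 1 - a) := by
  induction u generalizing n with
  | nil => simp [applyMorphism]
  | cons a u ih =>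
    have h : applyMorphism delta (a :: u) = 0 :: (1 - a) :: applyMorphism delta u := by
      fin_cases a <;> rfl
    rw [h]
    cases n with
    | zero => simp
    | succ n => simpa [Nat.mul_succ] using ih n

theorem getElem?_deltaIter {n k : ℕ} (h : n < 2 ^ k) : (deltaIter k)[n]? = some (d n) := by
  rw [deltaIter_eq_prefix_d]; simp [h]

theorem d_even (n : ℕ) : d (2 * n) = 0 := by
  have h : n < 2 ^ n := Nat.lt_two_pow_self
  have h1 := (getElem?_applyMorphism_delta (deltaIter n) n).1
  rw [← deltaIter_succ, getElem?_deltaIter (by rw [pow_succ]; omega), getElem?_deltaIter h] at h1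
  simpa using h1

theorem d_odd (n : ℕ) : d (2 * n + 1) = 1 - d n := by
  have h : n < 2 ^ n := Nat.lt_two_pow_self
  have h1 := (getElem?_applyMorphism_delta (deltaIter n) n).2
  rw [← deltaIter_succ, getElem?_deltaIter (by rw [pow_succ]; omega), getElem?_deltaIter h] at h1
  simpa using h1

theorem d_eq_zero_of_even {n : ℕ} (h : n % 2 = 0) : d n = 0 := by
  rw [← Nat.div_add_mod n 2, h]; exact d_even _

theorem odd_of_d_eq_one {n : ℕ} (h : d n = 1) : n % 2 = 1 := by
  by_contra hn
  rw [d_eq_zero_of_even (by omega)] at h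
  exact absurd h (by decide)

theorem exists_d_eq_one (i : ℕ) : ∃ j < 4, d (i + j) = 1 := by
  have key : ∀ m, ∃ n, m ≤ n ∧ n ≤ m + 1 ∧ d (2 * n + 1) = 1 := by
    intro m
    rcases Nat.mod_two_eq_zero_or_one m with h | h
    · exact ⟨m, le_rfl, by omega, by rw [d_odd, d_eq_zero_of_even h]; rfl⟩
    · exact ⟨m + 1, by omega, le_rfl, by rw [d_odd, d_eq_zero_of_even (by omega)]; rfl⟩
  obtain ⟨n, h1, h2, h3⟩ := key (i / 2)
  exact ⟨2 * n + 1 - i, by omega, by rwa [show i + (2 * n + 1 - i) = 2 * n + 1 by omega]⟩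

/-- An even period descends to its half on the odd positions. An odd period pairs each position with
one of the other parity, so one of the two equal letters is 0 and the window vanishes, against
`exists_d_eq_one`. -/
theorem not_periodic_window (q : ℕ) (hq : 0 < q) (i : ℕ) :
    ¬ ∀ j < 3 * q, d (i + j) = d (i + j + q) := by
  induction q using Nat.strong_induction_on generalizing i with
  | _ q ih =>
    intro h
    rcases Nat.mod_two_eq_zero_or_one q with hp | hp
    · refine ih (q / 2) (by omega) (by omega) (i / 2) fun j hj => ?_
      have h1 := h (2 * (i / 2 + j) + 1 - i) (by omega)
      rw [show i + (2 * (i / 2 + j) + 1 - i) = 2 * (i / 2 + j) + 1 by omega,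
        show 2 * (i / 2 + j) + 1 + q = 2 * (i / 2 + j + q / 2) + 1 by omega, d_odd, d_odd] at h1
      exact sub_right_injective h1
    · have hz : ∀ j < 3 * q, d (i + j) = 0 := by
        intro j hj
        rcases Nat.mod_two_eq_zero_or_one (i + j) with h0 | h0
        · exact d_eq_zero_of_even h0
        · rw [h j hj]; exact d_eq_zero_of_even (by omega)
      obtain ⟨j, hj, h1⟩ := exists_d_eq_one i
      have h0 : d (i + j) = 0 := by
        rcases lt_or_ge j (3 * q) with h2 | h2
        · exact hz j h2
        · have h3 := h (j - q) (by omega)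
          rw [show i + (j - q) + q = i + j by omega] at h3
          rw [← h3]
          exact hz _ (by omega)
      rw [h0] at h1
      exact absurd h1 (by decide)

/-! ### Occurrences of words -/

/-- `u` is read in `d` from position `i`. -/
def OccursAt : Word → ℕ → Prop
  | [], _ => True
  | a :: u, i => a = d i ∧ OccursAt u (i + 1)

/-- `u` occurs somewhere in `d`. -/
def Occurs (u : Word) : Prop := ∃ i, OccursAt u i

theorem occursAt_iff (u : Word) (i : ℕ) :
    OccursAt u i ↔ u = (List.range u.length).map (fun j => d (i + j)) := by
  induction u generalizing i with
  | nil => simp [OccursAt]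
  | cons a u ih =>
    have h : ∀ j, d (i + 1 + j) = d (i + (j + 1)) := fun j => by congr 1; omega
    simp [OccursAt, ih, List.range_succ_eq_map, Function.comp_def, h]

theorem isFactor_iff_occurs (u : Word) : IsFactor u d ↔ Occurs u := by
  simp only [IsFactor, Occurs, occursAt_iff]

theorem occursAt_append {u v : Word} {i : ℕ} :
    OccursAt (u ++ v) i ↔ OccursAt u i ∧ OccursAt v (i + u.length) := by
  induction u generalizing i with
  | nil => simp [OccursAt]
  | cons a u ih =>
    simp only [List.cons_append, OccursAt, ih, List.length_cons, and_assoc]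
    rw [show i + 1 + u.length = i + (u.length + 1) by omega]

theorem OccursAt.getElem {u : Word} {i : ℕ} (h : OccursAt u i) (j : ℕ) (hj : j < u.length) :
    u[j] = d (i + j) := by
  rw [occursAt_iff] at h
  rw [List.getElem_of_eq h hj]; simp

theorem OccursAt.eq {u v : Word} {i : ℕ} (hu : OccursAt u i) (hv : OccursAt v i)
    (h : u.length = v.length) : u = v := by
  rw [occursAt_iff] at hu hv
  rw [hu, hv, h]

theorem Occurs.mono {u v : Word} (h : u <:+: v) (hv : Occurs v) : Occurs u := by
  obtain ⟨s, t, rfl⟩ := h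
  obtain ⟨i, hi⟩ := hv
  exact ⟨_, (occursAt_append.1 (occursAt_append.1 hi).1).2⟩

theorem occurs_deltaIter (k : ℕ) : Occurs (deltaIter k) := by
  refine ⟨0, (occursAt_iff _ _).2 ?_⟩
  rw [length_deltaIter]; simpa using deltaIter_eq_prefix_d k

theorem OccursAt.infix {u v : Word} {i j : ℕ} (hu : OccursAt u i) (hv : OccursAt v j)
    (h : j ≤ i) (h' : i + u.length ≤ j + v.length) : u <:+: v := by
  have h1 : v = v.take (i - j) ++ ((v.drop (i - j)).take u.length ++
      (v.drop (i - j)).drop u.length) := by simp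
  rw [h1, occursAt_append, occursAt_append] at hv
  have h2 := hv.2.1
  rw [List.length_take, min_eq_left (by omega), Nat.add_sub_cancel' h] at h2
  rw [hu.eq h2 (by simp; omega)]
  exact (List.take_prefix _ _).isInfix.trans (List.drop_suffix _ _).isInfix

theorem OccursAt.parity {u : Word} {i j : ℕ} (hi : OccursAt u i) (hj : OccursAt u j)
    (h : (1 : Fin 2) ∈ u) : i % 2 = j % 2 := by
  induction u generalizing i j with
  | nil => simp at h
  | cons a u ih =>
    rcases List.mem_cons.1 h with h | h
    · subst h
      rw [odd_of_d_eq_one hi.1.symm, odd_of_d_eq_one hj.1.symm]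
    · have := ih hi.2 hj.2 h
      omega

theorem OccursAt.append_zero {u : Word} {i : ℕ} (h : OccursAt u i)
    (hp : (i + u.length) % 2 = 0) : OccursAt (u ++ [0]) i :=
  occursAt_append.2 ⟨h, (d_eq_zero_of_even hp).symm, trivial⟩

theorem not_occurs_fourth_power {u : Word} (h : u ≠ []) : ¬ Occurs (u ++ (u ++ (u ++ u))) := by
  rintro ⟨i, hi⟩
  have h1 : OccursAt (u ++ (u ++ u)) (i + u.length) := (occursAt_append.1 hi).2
  have h2 : OccursAt (u ++ (u ++ u)) i := by
    rw [show u ++ (u ++ (u ++ u)) = (u ++ (u ++ u)) ++ u by simp] at hi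
    exact (occursAt_append.1 hi).1
  refine not_periodic_window u.length (List.length_pos_iff.2 h) i fun j hj => ?_
  have hj' : j < (u ++ (u ++ u)).length := by simp; omega
  rw [← h2.getElem j hj', h1.getElem j hj']
  congr 1; omega

/-- The word `0ⁿ`. -/
abbrev zeros (n : ℕ) : Word := List.replicate n 0

theorem zeros_add (m n : ℕ) : zeros (m + n) = zeros m ++ zeros n :=
  List.replicate_add _ _ _

theorem not_occurs_zeros {n : ℕ} (h : 4 ≤ n) : ¬ Occurs (zeros n) := by
  intro ⟨i, hi⟩
  obtain ⟨j, hj, h1⟩ := exists_d_eq_one i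
  have := hi.getElem j (by simp; omega)
  rw [h1] at this
  simp at this

theorem eq_zeros_of_one_notMem {u : Word} (h : (1 : Fin 2) ∉ u) : u = zeros u.length := by
  refine List.eq_replicate_iff.2 ⟨rfl, fun b hb => ?_⟩
  have : b ≠ 1 := fun hb' => h (hb' ▸ hb)
  omega

/-! ### Desubstitution -/

/-- The complemented letters of `u` at its odd (`b = false`) or even (`b = true`) indices. -/
def half (b : Bool) : Word → Word
  | x :: y :: t => (1 - bif b then x else y) :: half b t
  | _ => []

theorem half_append (b : Bool) (v : Word) : ∀ u : Word, u.length % 2 = 0 →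
    half b (u ++ v) = half b u ++ half b v
  | [], _ => by simp [half]
  | [x], h => by simp at h
  | x :: y :: t, h => by
    have := half_append b v t (by simp at h; omega)
    simp [half, this]

theorem length_half (b : Bool) : ∀ u : Word, (half b u).length = u.length / 2
  | [] => rfl
  | [x] => by simp [half]
  | x :: y :: t => by simp [half, length_half b t]; omega

theorem OccursAt.half_false {m : ℕ} : ∀ {u : Word}, OccursAt u (2 * m) →
    OccursAt (half false u) m
  | [], _ => trivial
  | [x], _ => trivial
  | x :: y :: t, h => by
    refine ⟨?_, OccursAt.half_false (m := m + 1) h.2.2⟩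
    rw [h.2.1, d_odd]; simp

theorem OccursAt.half_true {m : ℕ} : ∀ {u : Word}, OccursAt u (2 * m + 1) →
    OccursAt (half true u) m
  | [], _ => trivial
  | [x], _ => trivial
  | x :: y :: t, h => by
    refine ⟨?_, OccursAt.half_true (m := m + 1) h.2.2⟩
    rw [h.1, d_odd]; simp

theorem Occurs.exists_half {u : Word} (h : Occurs u) : ∃ b, Occurs (half b u) := by
  obtain ⟨i, hi⟩ := h
  rcases Nat.even_or_odd' i with ⟨m, rfl | rfl⟩
  · exact ⟨false, m, hi.half_false⟩
  · exact ⟨true, m, hi.half_true⟩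

@[simp] theorem applyMorphism_nil (g : Fin 2 → Word) : applyMorphism g [] = [] := rfl

@[simp] theorem applyMorphism_cons (g : Fin 2 → Word) (a : Fin 2) (u : Word) :
    applyMorphism g (a :: u) = g a ++ applyMorphism g u := by
  simp [applyMorphism]

@[simp] theorem applyMorphism_append (g : Fin 2 → Word) (u v : Word) :
    applyMorphism g (u ++ v) = applyMorphism g u ++ applyMorphism g v := by
  simp [applyMorphism]

theorem applyMorphism_infix (g : Fin 2 → Word) {u v : Word} (h : u <:+: v) :
    applyMorphism g u <:+: applyMorphism g v := by
  obtain ⟨s, t, rfl⟩ := h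
  exact ⟨applyMorphism g s, applyMorphism g t, by simp⟩

theorem length_le_length_applyMorphism {g : Fin 2 → Word} (hg : ∀ a, g a ≠ []) (u : Word) :
    u.length ≤ (applyMorphism g u).length := by
  induction u with
  | nil => simp
  | cons a u ih =>
    have := List.length_pos_iff.2 (hg a)
    rw [applyMorphism_cons, List.length_append, List.length_cons]
    omega

theorem applyMorphism_complement (g : Fin 2 → Word) (u : Word) :
    applyMorphism g (complement u) = applyMorphism (fun a => g (1 - a)) u := by
  simp [applyMorphism, complement, List.flatMap_map]

@[simp] theorem complement_complement (u : Word) : complement (complement u) = u := by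
  simp [complement]

/-- Even block lengths keep the parity aligned from block to block, so halving acts on the morphism
and leaves the pattern unchanged. -/
theorem applyMorphism_half {g : Fin 2 → Word} (b : Bool) (hg : ∀ a, (g a).length % 2 = 0)
    (u : Word) : applyMorphism (fun a => half b (g a)) u = half b (applyMorphism g u) := by
  induction u with
  | nil => simp [half]
  | cons a u ih => simp [ih, half_append b _ _ (hg a)]

/-! ### The factors of bounded length -/

theorem OccursAt.delta {u : Word} {i : ℕ} (h : OccursAt u i) :
    OccursAt (applyMorphism delta u) (2 * i) := by
  induction u generalizing i with
  | nil => trivial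
  | cons a u ih =>
    have h1 : applyMorphism PeriodDoubling.delta (a :: u) =
        0 :: (1 - a) :: applyMorphism PeriodDoubling.delta u := by
      fin_cases a <;> rfl
    rw [h1]
    exact ⟨(d_even i).symm, by rw [d_odd, h.1], ih h.2⟩

theorem OccursAt.delta_iterate {u : Word} {i : ℕ} (h : OccursAt u i) (k : ℕ) :
    OccursAt ((applyMorphism PeriodDoubling.delta)^[k] u) (2 ^ k * i) := by
  induction k with
  | zero => simpa
  | succ k ih =>
    rw [Function.iterate_succ_apply', pow_succ', mul_assoc]
    exact ih.delta

theorem length_delta_iterate (u : Word) (k : ℕ) :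
    ((applyMorphism delta)^[k] u).length = 2 ^ k * u.length := by
  induction k with
  | zero => simp
  | succ k ih => rw [Function.iterate_succ_apply', length_applyMorphism_delta, ih, pow_succ']; ring

/-- A factor starting at offset at most 2^k - 1 in a block of length 2^k ends within the next block
when its length is at most 2^k + 1. The two blocks come from adjacent letters, which are not both 1.
-/
theorem Occurs.infix_delta_iterate {u : Word} (h : Occurs u) (k : ℕ)
    (hk : u.length ≤ 2 ^ k + 1) :
    ∃ v ∈ ([[0, 0], [0, 1], [1, 0]] : List Word), u <:+: (applyMorphism delta)^[k] v := by
  obtain ⟨i, hi⟩ := h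
  set m := i / 2 ^ k
  have hm : OccursAt [d m, d (m + 1)] m := ⟨rfl, rfl, trivial⟩
  refine ⟨[d m, d (m + 1)], ?_, hi.infix (hm.delta_iterate k) (Nat.mul_div_le _ _) ?_⟩
  · have h2 : d m = 0 ∨ d (m + 1) = 0 := by
      rcases Nat.mod_two_eq_zero_or_one m with h | h
      · exact Or.inl (d_eq_zero_of_even h)
      · exact Or.inr (d_eq_zero_of_even (by omega))
    generalize d m = x, d (m + 1) = y at h2
    revert x y; decide
  · rw [length_delta_iterate]
    have := Nat.lt_mul_div_succ i (Nat.two_pow_pos k)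
    simp only [List.length_cons, List.length_nil]
    change i < 2 ^ k * (m + 1) at this
    rw [Nat.mul_add] at this
    omega

/-! ### Finite search among the words avoiding given factors -/

/-- The right-hand side of the classification. -/
def IsClassified (p : Word) : Prop :=
  (IsRegular p ∨ IsRegular (complement p)) ∨ (p ∈ sporadic ∨ complement p ∈ sporadic)

theorem IsClassified.of_complement {p : Word} (h : IsClassified (complement p)) :
    IsClassified p := by
  unfold IsClassified at *
  rw [complement_complement] at h
  tauto

/-- The prefix of length 32 of `d`. -/
def prefix32 : Word :=
  [0, 1, 0, 0, 0, 1, 0, 1, 0, 1, 0, 0, 0, 1, 0, 0, 0, 1, 0, 0, 0, 1, 0, 1, 0, 1, 0, 0, 0, 1, 0, 1]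

theorem occurs_prefix32 : Occurs prefix32 := by
  have h : prefix32 = deltaIter 5 := by decide +kernel
  rw [h]; exact occurs_deltaIter 5

/-- A sufficient condition for `IsRegular`, decidable on the prefix of length 32. -/
def regularTest (p : Word) : Bool :=
  decide (p <:+: prefix32) || decide (applyMorphism h₁ p <:+: prefix32) ||
    decide (applyMorphism h₂ p <:+: prefix32)

/-- A sufficient condition for `IsClassified`, decidable on the prefix of length 32. -/
def classifiedTest (p : Word) : Bool :=
  regularTest p || regularTest (complement p) || decide (p ∈ sporadic) ||
    decide (complement p ∈ sporadic)

theorem IsRegular.of_test {p : Word} (h : regularTest p = true) : IsRegular p := by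
  have key : ∀ {u : Word}, u <:+: prefix32 → IsFactor u d := fun hu =>
    (isFactor_iff_occurs _).2 (occurs_prefix32.mono hu)
  simp only [regularTest, Bool.or_eq_true, decide_eq_true_eq] at h
  rcases h with (h | h) | h
  · exact Or.inl (key h)
  · exact Or.inr (Or.inl ⟨p, List.infix_rfl, key h⟩)
  · exact Or.inr (Or.inr ⟨p, List.infix_rfl, key h⟩)

theorem IsClassified.of_test {p : Word} (h : classifiedTest p = true) : IsClassified p := by
  simp only [classifiedTest, Bool.or_eq_true, decide_eq_true_eq] at h
  rcases h with ((h | h) | h) | h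
  · exact Or.inl (Or.inl (.of_test h))
  · exact Or.inl (Or.inr (.of_test h))
  · exact Or.inr (Or.inl h)
  · exact Or.inr (Or.inr h)

/-- The left extensions by one letter of the words in `ws` having no prefix in `F`. -/
def extensions (F ws : List Word) : List Word :=
  ws.flatMap fun w => [0 :: w, 1 :: w].filter fun v => F.all fun f => !f.isPrefixOf v

/-- Whether all repeated left extensions of words of `ws` avoiding `F` pass the test, and there
is none after `n` steps. -/
def search (F : List Word) : ℕ → List Word → Bool
  | 0, ws => ws.isEmpty
  | n + 1, ws => ws.all classifiedTest && search F n (extensions F ws)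

/-- The last letter of `t` moves onto `w` at each step. Testing prefixes suffices, because a new
forbidden factor must begin at the letter just added. -/
theorem classifiedTest_of_search {F : List Word} {n : ℕ} {ws : List Word}
    (h : search F n ws = true) {t w : Word} (hw : w ∈ ws)
    (hF : ∀ f ∈ F, ¬ f <:+: t ++ w) : classifiedTest (t ++ w) = true := by
  induction n generalizing ws t w with
  | zero =>
    rw [search, List.isEmpty_iff] at h
    simp [h] at hw
  | succ n ih =>
    rw [search, Bool.and_eq_true, List.all_eq_true] at h
    rcases List.eq_nil_or_concat t with rfl | ⟨t, x, rfl⟩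
    · exact h.1 w hw
    · have h1 : t.concat x ++ w = t ++ x :: w := by simp
      rw [h1] at hF ⊢
      refine ih h.2 (List.mem_flatMap.2 ⟨w, hw, List.mem_filter.2 ⟨?_, ?_⟩⟩) hF
      · have : ∀ y : Fin 2, y = 0 ∨ y = 1 := by decide
        rcases this x with rfl | rfl <;> simp
      · rw [List.all_eq_true]
        intro f hf
        by_contra hc
        have hc' : f <+: x :: w := by simpa using hc
        exact hF f hf (hc'.isInfix.trans (List.suffix_append _ _).isInfix)

theorem IsClassified.of_avoids (F : List Word) (n : ℕ) (h : search F n [[]] = true) {p : Word}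
    (hF : ∀ f ∈ F, ¬ f <:+: p) : IsClassified p := by
  have := classifiedTest_of_search h (t := p) (List.mem_singleton.2 rfl) (by simpa using hF)
  exact .of_test (by simpa using this)

/-! ### Images of letters that both contain the letter `1` -/

theorem even_length_of_occurs {u v : Word} (hu : (1 : Fin 2) ∈ u)
    (h : Occurs (u ++ (v ++ u))) : (u.length + v.length) % 2 = 0 := by
  obtain ⟨i, hi⟩ := h
  have h1 := (occursAt_append.1 hi)
  have h2 := (occursAt_append.1 h1.2).2
  have := h1.1.parity h2 hu
  omega

theorem isClassified_of_one_mem {g : Fin 2 → Word} {p : Word} (h0 : (1 : Fin 2) ∈ g 0)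
    (h1 : (1 : Fin 2) ∈ g 1) (hodd : ¬ ((g 0).length % 2 = 0 ∧ (g 1).length % 2 = 0))
    (h : Occurs (applyMorphism g p)) : IsClassified p := by
  have key : ∀ f, f <:+: p → Occurs (applyMorphism g f) :=
    fun f hf => h.mono (applyMorphism_infix g hf)
  have hn0 : g 0 ≠ [] := List.ne_nil_of_mem h0
  have hn1 : g 1 ≠ [] := List.ne_nil_of_mem h1
  have e0 : ∀ v, Occurs (g 0 ++ (v ++ g 0)) → ((g 0).length + v.length) % 2 = 0 :=
    fun v => even_length_of_occurs h0
  have e1 : ∀ v, Occurs (g 1 ++ (v ++ g 1)) → ((g 1).length + v.length) % 2 = 0 :=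
    fun v => even_length_of_occurs h1
  have p0 := not_occurs_fourth_power hn0
  have p1 := not_occurs_fourth_power hn1
  have p01 := not_occurs_fourth_power (u := g 0 ++ g 1) (by simp [hn0])
  have p10 := not_occurs_fourth_power (u := g 1 ++ g 0) (by simp [hn0])
  have a00 := e0 []
  have a010 := e0 (g 1)
  have a0110 := e0 (g 1 ++ g 1)
  have a01110 := e0 (g 1 ++ (g 1 ++ g 1))
  have a11 := e1 []
  have a101 := e1 (g 0)
  have a1001 := e1 (g 0 ++ g 0)
  have a10001 := e1 (g 0 ++ (g 0 ++ g 0))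
  simp only [List.append_assoc, List.nil_append, List.length_append, List.length_nil] at *
  rcases Nat.mod_two_eq_zero_or_one (g 0).length with c0 | c0 <;>
    rcases Nat.mod_two_eq_zero_or_one (g 1).length with c1 | c1
  · exact absurd ⟨c0, c1⟩ hodd
  · refine .of_avoids [[1, 1], [1, 0, 1], [0, 1, 0], [1, 0, 0, 1], [1, 0, 0, 0, 1], [0, 0, 0, 0]]
      6 (by decide +kernel) fun f hf hfp => ?_
    have ho := key f hfp
    simp only [List.mem_cons, List.not_mem_nil, or_false] at hf
    rcases hf with rfl | rfl | rfl | rfl | rfl | rfl <;>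
      simp only [applyMorphism_cons, applyMorphism_nil, List.append_nil] at ho
    · have := a11 ho; omega
    · have := a101 ho; omega
    · have := a010 ho; omega
    · have := a1001 ho; omega
    · have := a10001 ho; omega
    · exact p0 ho
  · refine .of_avoids [[0, 0], [0, 1, 0], [1, 0, 1], [0, 1, 1, 0], [0, 1, 1, 1, 0], [1, 1, 1, 1]]
      6 (by decide +kernel) fun f hf hfp => ?_
    have ho := key f hfp
    simp only [List.mem_cons, List.not_mem_nil, or_false] at hf
    rcases hf with rfl | rfl | rfl | rfl | rfl | rfl <;>
      simp only [applyMorphism_cons, applyMorphism_nil, List.append_nil] at ho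
    · have := a00 ho; omega
    · have := a010 ho; omega
    · have := a101 ho; omega
    · have := a0110 ho; omega
    · have := a01110 ho; omega
    · exact p1 ho
  · refine .of_avoids [[0, 0], [1, 1], [0, 1, 0, 1, 0, 1, 0, 1], [1, 0, 1, 0, 1, 0, 1, 0]]
      9 (by decide +kernel) fun f hf hfp => ?_
    have ho := key f hfp
    simp only [List.mem_cons, List.not_mem_nil, or_false] at hf
    rcases hf with rfl | rfl | rfl | rfl <;>
      simp only [applyMorphism_cons, applyMorphism_nil, List.append_nil] at ho
    · have := a00 ho; omega
    · have := a11 ho; omega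
    · exact p01 ho
    · exact p10 ho

/-! ### Words delimited by the letter `1` -/

theorem exists_eq_zeros_append {u : Word} (h : (1 : Fin 2) ∈ u) :
    ∃ a v, u = zeros a ++ 1 :: v := by
  obtain ⟨s, t, rfl, hs⟩ := List.eq_append_cons_of_mem h
  exact ⟨s.length, t, by rw [← eq_zeros_of_one_notMem hs]⟩

/-- `u` begins and ends in the letter `1`. -/
def IsDelimited (u : Word) : Prop := (∃ v, u = 1 :: v) ∧ ∃ v, u = v ++ [1]

theorem exists_delimited {u : Word} (h : (1 : Fin 2) ∈ u) :
    ∃ a b v, IsDelimited v ∧ u = zeros a ++ (v ++ zeros b) := by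
  obtain ⟨a, v, rfl⟩ := exists_eq_zeros_append h
  obtain ⟨b, w, hw⟩ := exists_eq_zeros_append (u := (1 :: v).reverse) (by simp)
  have h1 : 1 :: v = (w.reverse ++ [1]) ++ zeros b := by
    rw [← List.reverse_reverse (1 :: v), hw]; simp
  refine ⟨a, b, w.reverse ++ [1], ⟨?_, _, rfl⟩, by rw [← h1]⟩
  cases hr : w.reverse with
  | nil => exact ⟨[], rfl⟩
  | cons x r =>
    rw [hr] at h1
    obtain rfl : (1 : Fin 2) = x := by simpa using (List.cons.inj h1).1
    exact ⟨r ++ [1], rfl⟩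

theorem IsDelimited.odd {u : Word} (h : IsDelimited u) {i : ℕ} (hi : OccursAt u i) :
    i % 2 = 1 ∧ u.length % 2 = 1 := by
  obtain ⟨⟨v, hv⟩, w, hw⟩ := h
  have h1 : d i = 1 := by rw [hv] at hi; exact hi.1.symm
  have h2 : d (i + w.length) = 1 := by
    rw [hw] at hi; exact (occursAt_append.1 hi).2.1.symm
  have := odd_of_d_eq_one h1
  have := odd_of_d_eq_one h2
  refine ⟨by assumption, ?_⟩
  rw [hw, List.length_append, List.length_singleton]
  omega

theorem IsDelimited.ne_nil {u : Word} (h : IsDelimited u) : u ≠ [] := by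
  obtain ⟨⟨v, rfl⟩, -⟩ := h; simp

theorem IsDelimited.gap {u : Word} (h : IsDelimited u) {n : ℕ}
    (ho : Occurs (u ++ (zeros n ++ u))) : n = 1 ∨ n = 3 := by
  have h4 : n < 4 := by
    by_contra hn
    exact not_occurs_zeros (not_lt.1 hn) (ho.mono ⟨u, u, by simp⟩)
  obtain ⟨i, hi⟩ := ho
  have h1 := occursAt_append.1 hi
  have h2 := occursAt_append.1 h1.2
  have := h.odd h1.1
  have := h.odd h2.2
  simp only [List.length_replicate] at this
  omega

/-- Let z be the desubstitution of u0. The two gaps give occurrences of zz and z1z. If z contained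
1, both |z| and |z| + 1 would be even; so z is a block of zeros, and zz being shorter than 0000
forces |z| = 1. -/
theorem IsDelimited.eq_singleton {u : Word} (h : IsDelimited u)
    (ho1 : Occurs (u ++ (zeros 1 ++ u))) (ho3 : Occurs (u ++ (zeros 3 ++ u))) : u = [1] := by
  obtain ⟨i, hi⟩ := ho1
  obtain ⟨j, hj⟩ := ho3
  obtain ⟨hi1, hu⟩ := h.odd (occursAt_append.1 hi).1
  obtain ⟨hj1, -⟩ := h.odd (occursAt_append.1 hj).1
  set z := half true (u ++ [0]) with hz
  have hlen : (u ++ [0]).length % 2 = 0 := by simp; omega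
  have hi2 := hi.append_zero (by simp; omega)
  have hj2 := hj.append_zero (by simp; omega)
  rw [show u ++ (zeros 1 ++ u) ++ [0] = (u ++ [0]) ++ (u ++ [0]) by simp [zeros],
    ← Nat.div_add_mod i 2, hi1] at hi2
  rw [show u ++ (zeros 3 ++ u) ++ [0] = (u ++ [0]) ++ ([0, 0] ++ (u ++ [0])) by
    simp [zeros, List.replicate], ← Nat.div_add_mod j 2, hj1] at hj2
  have hzz := hi2.half_true
  have hz1z := hj2.half_true
  rw [half_append _ _ _ hlen, ← hz] at hzz
  rw [half_append _ _ _ hlen, half_append _ _ [0, 0] (by rfl), ← hz] at hz1z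
  have hl : z.length = (u.length + 1) / 2 := by rw [hz, length_half]; simp
  by_cases h1 : (1 : Fin 2) ∈ z
  · have e1 := even_length_of_occurs (v := []) h1 ⟨_, hzz⟩
    have e2 := even_length_of_occurs h1 ⟨_, hz1z⟩
    simp [half] at e1 e2
    omega
  · have h2 := eq_zeros_of_one_notMem h1
    have h3 : z.length < 2 := by
      by_contra hc
      refine not_occurs_zeros (n := z.length + z.length) (by omega) ?_
      rw [zeros_add, ← h2]
      exact ⟨_, hzz⟩
    obtain ⟨⟨v, rfl⟩, -⟩ := h
    have : v = [] := by
      simp only [List.length_cons] at hl hu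
      exact List.length_eq_zero_iff.1 (by omega)
    rw [this]

/-- The next letter is a forced 0, and 00(u0)(u0)00 desubstitutes to 1zz1, whose outer ones are at
the odd distance 2|z| + 1. -/
theorem IsDelimited.not_occurs_square {u : Word} (h : IsDelimited u) :
    ¬ Occurs (zeros 2 ++ (u ++ (zeros 1 ++ (u ++ zeros 2)))) := by
  rintro ⟨i, hi⟩
  have h1 := occursAt_append.1 hi
  have h2 := occursAt_append.1 h1.2
  obtain ⟨hp, hu⟩ := h.odd h2.1
  simp only [List.length_replicate] at hp
  have hi2 := hi.append_zero (by simp; omega)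
  rw [show zeros 2 ++ (u ++ (zeros 1 ++ (u ++ zeros 2))) ++ [0] =
      [0, 0] ++ ((u ++ [0]) ++ ((u ++ [0]) ++ [0, 0])) by simp [zeros, List.replicate],
    ← Nat.div_add_mod i 2, show i % 2 = 1 by omega] at hi2
  have h3 := hi2.half_true
  have hlen : (u ++ [0]).length % 2 = 0 := by simp; omega
  rw [half_append _ _ _ (by rfl), half_append _ _ _ hlen, half_append _ _ _ hlen] at h3
  have h4 := even_length_of_occurs (u := half true [0, 0]) (v := half true (u ++ [0]) ++
    half true (u ++ [0])) (by decide) ⟨_, by simpa using h3⟩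
  simp [half] at h4
  omega

/-- In this and the next two lemmas, the letter missing from a fourth power falls on an even
position, hence is 0. -/
theorem IsDelimited.not_occurs_fourth_power_one {u : Word} (h : IsDelimited u) :
    ¬ Occurs (u ++ (zeros 1 ++ (u ++ (zeros 1 ++ (u ++ (zeros 1 ++ u)))))) := by
  rintro ⟨i, hi⟩
  obtain ⟨hp, hu⟩ := h.odd (occursAt_append.1 hi).1
  refine not_occurs_fourth_power (u := u ++ zeros 1) (by simp) ⟨i, ?_⟩
  have := hi.append_zero (by simp; omega)
  simpa [zeros] using this

theorem IsDelimited.not_occurs_fourth_power_right {u : Word} (h : IsDelimited u) :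
    ¬ Occurs (u ++ (zeros 3 ++ (u ++ (zeros 3 ++ (u ++ (zeros 3 ++ (u ++ zeros 2))))))) := by
  rintro ⟨i, hi⟩
  obtain ⟨hp, hu⟩ := h.odd (occursAt_append.1 hi).1
  refine not_occurs_fourth_power (u := u ++ zeros 3) (by simp) ⟨i, ?_⟩
  have := hi.append_zero (by simp; omega)
  simpa [zeros, List.replicate] using this

theorem IsDelimited.not_occurs_fourth_power_left {u : Word} (h : IsDelimited u) :
    ¬ Occurs (zeros 2 ++ (u ++ (zeros 3 ++ (u ++ (zeros 3 ++ (u ++ (zeros 3 ++ u))))))) := by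
  rintro ⟨i, hi⟩
  obtain ⟨hp, hu⟩ := h.odd (occursAt_append.1 (occursAt_append.1 hi).2).1
  simp only [List.length_replicate] at hp
  refine not_occurs_fourth_power (u := zeros 3 ++ u) (by simp) ⟨i - 1, ?_⟩
  have h0 : OccursAt
      (0 :: (zeros 2 ++ (u ++ (zeros 3 ++ (u ++ (zeros 3 ++ (u ++ (zeros 3 ++ u)))))))) (i - 1) :=
    ⟨(d_eq_zero_of_even (by omega)).symm, by rwa [Nat.sub_add_cancel (by omega)]⟩
  simpa [zeros, List.replicate] using h0

/-! ### Images of which exactly one contains the letter `1` -/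

/-- Words that cannot occur in `p` if `[0ᶜ, 0ᵃ u 0ᵇ]` maps `p` to a factor of `d`, the word `u` is
delimited by ones, and consecutive occurrences of `u` are separated by `0ᶠ`. -/
def forbidden (c a b f : ℕ) : List Word :=
  [zeros 4] ++
  ((List.range 4).filter (fun m => 4 ≤ c * m + a)).map (fun m => zeros m ++ [1]) ++
  ((List.range 4).filter (fun m => 4 ≤ b + c * m)).map (fun m => [1] ++ zeros m) ++
  ((List.range 4).filter (fun m => b + c * m + a ≠ f)).map (fun m => [1] ++ (zeros m ++ [1])) ++
  ((List.range 4).filter (fun e => b + c * e + a = f)).flatMap (fun e =>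
    if f = 1 then
      [[1] ++ (zeros e ++ ([1] ++ (zeros e ++ ([1] ++ (zeros e ++ [1])))))] ++
      ((List.range 4).filter (fun i => 2 ≤ c * i + a)).flatMap (fun i =>
        ((List.range 4).filter (fun j => 2 ≤ b + c * j)).map (fun j =>
          zeros i ++ ([1] ++ (zeros e ++ ([1] ++ zeros j)))))
    else
      [[1] ++ (zeros e ++ ([1] ++ (zeros e ++ ([1] ++ (zeros e ++ ([1] ++ zeros e))))))] ++
      ((List.range 4).filter (fun i => 2 ≤ c * i + a)).map (fun i =>
        zeros i ++ ([1] ++ (zeros e ++ ([1] ++ (zeros e ++ ([1] ++ (zeros e ++ [1]))))))) ++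
      ((List.range 4).filter (fun j => 2 ≤ b + c * j)).map (fun j =>
        [1] ++ (zeros e ++ ([1] ++ (zeros e ++ ([1] ++ (zeros e ++ ([1] ++ zeros j))))))))

/-- The absence of 0000 bounds c, a and b by 3. Depth 16 allows for words of length 15, the length
of the longest sporadic word. -/
theorem search_forbidden : ∀ c ∈ [1, 2, 3], ∀ a ∈ List.range 4, ∀ b ∈ List.range 4,
    ∀ f ∈ [1, 3], search (forbidden c a b f) 16 [[]] = true := by
  decide +kernel

theorem applyMorphism_zeros {g : Fin 2 → Word} {c : ℕ} (h : g 0 = zeros c) (n : ℕ) :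
    applyMorphism g (zeros n) = zeros (c * n) := by
  induction n with
  | zero => simp
  | succ n ih =>
    rw [zeros, List.replicate_succ, applyMorphism_cons, ih, h, Nat.mul_succ, Nat.add_comm]
    simp

theorem isClassified_of_gap {g : Fin 2 → Word} {p u : Word} {a b c f : ℕ} (hu : IsDelimited u)
    (h0 : g 0 = zeros c) (h1 : g 1 = zeros a ++ (u ++ zeros b)) (hc : 1 ≤ c ∧ c ≤ 3)
    (ha : a ≤ 3) (hb : b ≤ 3) (hf : f = 1 ∨ f = 3)
    (hgap : ∀ m, [1] ++ (zeros m ++ [1]) <:+: p → b + c * m + a = f)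
    (h : Occurs (applyMorphism g p)) : IsClassified p := by
  have key : ∀ q v s t, applyMorphism g q = s ++ (v ++ t) → ¬ Occurs v → ¬ q <:+: p := by
    intro q v s t hq hv hqp
    refine hv ((h.mono (applyMorphism_infix g hqp)).mono ?_)
    rw [hq]
    exact ⟨s, t, by simp⟩
  have split : ∀ {m n : ℕ}, m ≤ n → zeros n = zeros (n - m) ++ zeros m ∧
      zeros n = zeros m ++ zeros (n - m) := by
    intro m n hmn
    constructor <;> rw [← zeros_add] <;> congr 1 <;> omega
  have letter : applyMorphism g [1] = zeros a ++ (u ++ zeros b) := by simp [h1]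
  have gap : ∀ {m : ℕ} (w : Word), b + c * m + a = f →
      zeros b ++ (zeros (c * m) ++ (zeros a ++ w)) = zeros f ++ w := by
    intro m w hm
    rw [← hm]; simp only [zeros_add, List.append_assoc]
  refine .of_avoids (forbidden c a b f) 16 (search_forbidden c ?_ a ?_ b ?_ f ?_) fun q hq => ?_
  · simp; omega
  · simp; omega
  · simp; omega
  · simpa using hf
  simp only [forbidden, List.mem_append, List.mem_map, List.mem_filter, List.mem_singleton,
    List.mem_flatMap, List.mem_range, decide_eq_true_eq] at hq
  rcases hq with (((rfl | ⟨m, ⟨-, hm⟩, rfl⟩) | ⟨m, ⟨-, hm⟩, rfl⟩) | ⟨m, ⟨-, hm⟩, rfl⟩) |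
    ⟨e, ⟨-, he⟩, hq⟩
  · exact key _ (zeros (c * 4)) [] [] (by simp [applyMorphism_zeros h0])
      (not_occurs_zeros (by omega))
  · refine key _ (zeros (c * m + a)) [] (u ++ zeros b) ?_ (not_occurs_zeros hm)
    rw [applyMorphism_append, letter, applyMorphism_zeros h0]
    simp only [zeros_add, List.append_assoc, List.nil_append]
  · refine key _ (zeros (b + c * m)) (zeros a ++ u) [] ?_ (not_occurs_zeros hm)
    rw [applyMorphism_append, letter, applyMorphism_zeros h0]
    simp only [zeros_add, List.append_assoc, List.append_nil]
  · exact fun hp => hm (hgap m hp)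
  rcases hf with rfl | rfl
  · simp only [if_true, List.mem_append, List.mem_map, List.mem_filter, List.mem_singleton,
      List.mem_flatMap, List.mem_range, decide_eq_true_eq] at hq
    rcases hq with rfl | ⟨i, ⟨-, hi⟩, j, ⟨-, hj⟩, rfl⟩
    · refine key _ _ (zeros a) (zeros b) ?_ hu.not_occurs_fourth_power_one
      simp only [applyMorphism_append, letter, applyMorphism_zeros h0, List.append_assoc, gap _ he]
    · refine key _ _ (zeros (c * i + a - 2)) (zeros (b + c * j - 2)) ?_ hu.not_occurs_square
      simp only [applyMorphism_append, letter, applyMorphism_zeros h0, List.append_assoc, gap _ he]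
      -- Only two of the outer zeros on each side belong to the excluded word; the surplus is split
      -- off.
      rw [← List.append_assoc, ← zeros_add, ← zeros_add, (split hi).1,
        (split hj).2]
      simp only [List.append_assoc]
  · simp only [show ¬ (3 = 1) by decide, if_false, List.mem_append, List.mem_map, List.mem_filter,
      List.mem_singleton, List.mem_range, decide_eq_true_eq] at hq
    rcases hq with (rfl | ⟨i, ⟨-, hi⟩, rfl⟩) | ⟨j, ⟨-, hj⟩, rfl⟩
    · refine key _ _ [] [] ?_ (not_occurs_fourth_power
        (u := applyMorphism g ([1] ++ zeros e)) ?_)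
      · simp only [applyMorphism_append, List.append_assoc, List.nil_append, List.append_nil]
      · rw [applyMorphism_append, letter]
        simp [hu.ne_nil]
    · refine key _ _ (zeros (c * i + a - 2)) (zeros b) ?_ hu.not_occurs_fourth_power_left
      simp only [applyMorphism_append, letter, applyMorphism_zeros h0, List.append_assoc, gap _ he]
      rw [← List.append_assoc, ← zeros_add, (split hi).1]
      simp only [List.append_assoc]
    · refine key _ _ (zeros a) (zeros (b + c * j - 2)) ?_ hu.not_occurs_fourth_power_right
      simp only [applyMorphism_append, letter, applyMorphism_zeros h0, List.append_assoc, gap _ he]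
      rw [← zeros_add, (split hj).2]

theorem isClassified_of_zeros {g : Fin 2 → Word} {p : Word} (hg : ∀ a, g a ≠ [])
    (h0 : (1 : Fin 2) ∉ g 0) (h1 : (1 : Fin 2) ∈ g 1)
    (hodd : ¬ ((g 0).length % 2 = 0 ∧ (g 1).length % 2 = 0))
    (hp0 : [0] <:+: p) (hp1 : [1] <:+: p) (h : Occurs (applyMorphism g p)) : IsClassified p := by
  have hc := eq_zeros_of_one_notMem h0
  obtain ⟨a, b, u, hu, hg1⟩ := exists_delimited h1
  set c := (g 0).length with hcdef
  have hcpos : 1 ≤ c := List.length_pos_iff.2 (hg 0)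
  have o0 : Occurs (zeros c) := by
    have := h.mono (applyMorphism_infix g hp0)
    rwa [applyMorphism_cons, applyMorphism_nil, List.append_nil, hc] at this
  have o1 : Occurs (zeros a ++ (u ++ zeros b)) := by
    have := h.mono (applyMorphism_infix g hp1)
    rwa [applyMorphism_cons, applyMorphism_nil, List.append_nil, hg1] at this
  have hc3 : c ≤ 3 := by
    by_contra hn
    exact not_occurs_zeros (by omega) o0
  have ha : a ≤ 3 := by
    by_contra hn
    exact not_occurs_zeros (n := a) (by omega) (o1.mono (List.prefix_append _ _).isInfix)
  have hb : b ≤ 3 := by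
    by_contra hn
    exact not_occurs_zeros (n := b) (by omega) (o1.mono ⟨zeros a ++ u, [], by simp⟩)
  have hgap : ∀ m, [1] ++ (zeros m ++ [1]) <:+: p →
      Occurs (u ++ (zeros (b + c * m + a) ++ u)) := by
    intro m hm
    refine (h.mono (applyMorphism_infix g hm)).mono ⟨zeros a, zeros b, ?_⟩
    rw [applyMorphism_append, applyMorphism_append, applyMorphism_zeros hc, applyMorphism_cons,
      applyMorphism_nil, hg1]
    simp only [zeros_add, List.append_assoc, List.append_nil]
  by_cases hn1 : ∀ m, [1] ++ (zeros m ++ [1]) <:+: p → b + c * m + a = 1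
  · exact isClassified_of_gap hu hc hg1 ⟨hcpos, hc3⟩ ha hb (Or.inl rfl) hn1 h
  by_cases hn3 : ∀ m, [1] ++ (zeros m ++ [1]) <:+: p → b + c * m + a = 3
  · exact isClassified_of_gap hu hc hg1 ⟨hcpos, hc3⟩ ha hb (Or.inr rfl) hn3 h
  push Not at hn1 hn3
  obtain ⟨m, hm, hm1⟩ := hn1
  obtain ⟨n, hn, hn3⟩ := hn3
  have om := hgap m hm
  have on := hgap n hn
  have em := (hu.gap om).resolve_left hm1
  have en := (hu.gap on).resolve_right hn3
  rw [em] at om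
  rw [en] at on
  have hu1 := hu.eq_singleton on om
  subst hu1
  have hl : (g 1).length = a + 1 + b := by rw [hg1]; simp; omega
  -- The gaps 3 and 1 differ by a multiple of c, so c divides 2; c = 2 forces a + b = 1 and makes
  -- both images even in length.
  have hc1 : c = 1 := by
    have : c ≠ 3 := by rintro h3; rw [h3] at em en; omega
    have : c ≠ 2 := by rintro h2; rw [h2] at em en hodd; omega
    omega
  rw [hc1] at hc em en
  have hreg : a = 0 ∧ b = 0 ∨ a = 0 ∧ b = 1 ∨ a = 1 ∧ b = 0 := by omega
  have hgen : ∀ g' : Fin 2 → Word, g' 0 = g 0 → g' 1 = g 1 → g' = g := by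
    intro g' e0 e1
    funext x
    fin_cases x
    exacts [e0, e1]
  refine Or.inl (Or.inl ?_)
  rcases hreg with ⟨rfl, rfl⟩ | ⟨rfl, rfl⟩ | ⟨rfl, rfl⟩
  · have : applyMorphism g p = p := by
      rw [← hgen (fun x => [x]) hc.symm hg1.symm]
      simp [applyMorphism]
    rw [this] at h
    exact Or.inl ((isFactor_iff_occurs _).2 h)
  · rw [← hgen h₂ hc.symm hg1.symm] at h
    exact Or.inr (Or.inr ⟨p, List.infix_rfl, (isFactor_iff_occurs _).2 h⟩)
  · rw [← hgen h₁ hc.symm hg1.symm] at h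
    exact Or.inr (Or.inl ⟨p, List.infix_rfl, (isFactor_iff_occurs _).2 h⟩)

/-! ### The classification -/

theorem isClassified_of_letter_missing {g : Fin 2 → Word} {p : Word} (hg : ∀ a, g a ≠ [])
    (h : Occurs (applyMorphism g p)) (x : Fin 2) (hx : ¬ [x] <:+: p) : IsClassified p := by
  refine .of_avoids [[x], [1 - x, 1 - x, 1 - x, 1 - x]] 6
    (by clear hx; revert x; decide +kernel) fun f hf hfp => ?_
  simp only [List.mem_cons, List.not_mem_nil, or_false] at hf
  rcases hf with rfl | rfl
  · exact hx hfp
  · refine not_occurs_fourth_power (hg (1 - x)) ?_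
    simpa using h.mono (applyMorphism_infix g hfp)

/-- The image is a block of at most three zeros and at least as long as p. The forbidden list
consists of all words of length 4. -/
theorem isClassified_of_all_zeros {g : Fin 2 → Word} {p : Word} (hg : ∀ a, g a ≠ [])
    (h0 : ∀ a, (1 : Fin 2) ∉ g a) (h : Occurs (applyMorphism g p)) : IsClassified p := by
  have hlen : ∀ f ∈ (extensions [])^[4] [[]], f.length = 4 := by decide +kernel
  refine .of_avoids ((extensions [])^[4] [[]]) 6 (by decide +kernel) fun f hf hfp => ?_
  have h1 : (1 : Fin 2) ∉ applyMorphism g f := by simp [applyMorphism, h0]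
  have ho := h.mono (applyMorphism_infix g hfp)
  rw [eq_zeros_of_one_notMem h1] at ho
  exact not_occurs_zeros ((hlen f hf).ge.trans (length_le_length_applyMorphism hg f)) ho

theorem isClassified_of_occurs {g : Fin 2 → Word} {p : Word} (hg : ∀ a, g a ≠ [])
    (h : Occurs (applyMorphism g p)) : IsClassified p := by
  induction hn : (g 0).length + (g 1).length using Nat.strong_induction_on generalizing g with
  | _ n ih =>
  have l0 := List.length_pos_iff.2 (hg 0)
  have l1 := List.length_pos_iff.2 (hg 1)
  by_cases heven : (g 0).length % 2 = 0 ∧ (g 1).length % 2 = 0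
  · have hev : ∀ a, (g a).length % 2 = 0 := Fin.forall_fin_two.2 heven
    obtain ⟨b, hb⟩ := h.exists_half
    rw [← applyMorphism_half b hev] at hb
    refine ih _ ?_ (fun a => List.length_pos_iff.1 ?_) hb rfl
    · simp only [length_half]; omega
    · have := List.length_pos_iff.2 (hg a)
      have := hev a
      rw [length_half]; omega
  by_cases hp0 : [0] <:+: p
  swap
  · exact isClassified_of_letter_missing hg h 0 hp0
  by_cases hp1 : [1] <:+: p
  swap
  · exact isClassified_of_letter_missing hg h 1 hp1
  by_cases h0 : (1 : Fin 2) ∈ g 0 <;> by_cases h1 : (1 : Fin 2) ∈ g 1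
  · exact isClassified_of_one_mem h0 h1 heven h
  -- Exchanging the two letters of the pattern reduces to the case where only the image of 1
  -- contains 1.
  · have hcomp : ∀ {q : Word}, q <:+: p → complement q <:+: complement p := fun hq => hq.map _
    refine .of_complement (isClassified_of_zeros (g := fun a => g (1 - a)) (fun a => hg _) (by simpa using h1)
      (by simpa using h0) (fun hc => heven (by simpa using hc.symm)) (hcomp hp1) (hcomp hp0) ?_)
    rw [applyMorphism_complement]
    simpa using h
  · exact isClassified_of_zeros hg h0 h1 heven hp0 hp1 h
  · exact isClassified_of_all_zeros hg (Fin.forall_fin_two.2 ⟨h0, h1⟩) h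

theorem Encounters.of_complement {w : InfWord} {p : Word} (h : Encounters w (complement p)) :
    Encounters w p := by
  obtain ⟨g, hg, h⟩ := h
  exact ⟨fun a => g (1 - a), fun a => hg _, by rwa [← applyMorphism_complement]⟩

theorem Occurs.encounters {g : Fin 2 → Word} {p : Word} (hg : ∀ a, g a ≠ [])
    (h : Occurs (applyMorphism g p)) : Encounters d p :=
  ⟨g, hg, (isFactor_iff_occurs _).2 h⟩

theorem IsFactorOfInverseImage.occurs {p : Word} {h : Fin 2 → Word}
    (hp : IsFactorOfInverseImage p h d) : Occurs (applyMorphism h p) := by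
  obtain ⟨u, hpu, hu⟩ := hp
  exact ((isFactor_iff_occurs _).1 hu).mono (applyMorphism_infix h hpu)

theorem IsRegular.exists_occurs {p : Word} (h : IsRegular p) :
    ∃ g ∈ ([fun x => [x], h₁, h₂] : List (Fin 2 → Word)), Occurs (applyMorphism g p) := by
  rcases h with h | h | h
  · exact ⟨fun x => [x], by simp, by simpa [applyMorphism] using (isFactor_iff_occurs _).1 h⟩
  · exact ⟨h₁, by simp, h.occurs⟩
  · exact ⟨h₂, by simp, h.occurs⟩

theorem IsRegular.encounters {p : Word} (h : IsRegular p) : Encounters d p := by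
  obtain ⟨g, hg, ho⟩ := h.exists_occurs
  refine ho.encounters ?_
  revert g
  simp [h₁, h₂]

theorem encounters_of_mem_sporadic {p : Word} (h : p ∈ sporadic) : Encounters d p := by
  have key : ∀ p ∈ sporadic, ∃ u ∈ ([[0, 1, 0], [0, 1, 0, 1, 0, 1], [1, 0, 1, 0, 1, 0],
      [1, 0, 1, 0, 1]] : List Word), u ≠ [] ∧ applyMorphism ![[0], u] p <:+: deltaIter 7 := by
    decide +kernel
  obtain ⟨u, -, hu, hinf⟩ := key p h
  exact ((occurs_deltaIter 7).mono hinf).encounters (by simp [hu])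

theorem not_isRegular_of_mem_sporadic {p : Word}
    (h : p ∈ sporadic ∨ complement p ∈ sporadic) : ¬ IsRegular p := by
  intro hp
  obtain ⟨g, hg, ho⟩ := hp.exists_occurs
  have hmem : p ∈ sporadic ++ sporadic.map complement :=
    List.mem_append.2 (h.imp id fun h => List.mem_map.2 ⟨_, h, complement_complement p⟩)
  have key : ∀ p ∈ sporadic ++ sporadic.map complement,
      ∀ g ∈ ([fun x => [x], h₁, h₂] : List (Fin 2 → Word)),
      -- The longest image has length 27, from the complement of the longest sporadic word, so 2^4 +
      -- 1 would not suffice.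
      (applyMorphism g p).length ≤ 2 ^ 5 + 1 ∧ ∀ v ∈ ([[0, 0], [0, 1], [1, 0]] : List Word),
        ¬ applyMorphism g p <:+: (applyMorphism delta)^[5] v := by
    decide +kernel
  obtain ⟨h1, h2⟩ := key p hmem g hg
  obtain ⟨v, hv, hv'⟩ := ho.infix_delta_iterate 5 h1
  exact h2 v hv hv'

end PeriodDoubling

/-- The binary patterns encountered by the period-doubling word `d`: they are exactly the words
satisfying one of two conditions, and no word satisfies both. -/
theorem mainTheorem7 :
    (∀ p : PeriodDoubling.Word,
      PeriodDoubling.Encounters PeriodDoubling.d p ↔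
        ((PeriodDoubling.IsRegular p ∨ PeriodDoubling.IsRegular (PeriodDoubling.complement p)) ∨
          (p ∈ PeriodDoubling.sporadic ∨
            PeriodDoubling.complement p ∈ PeriodDoubling.sporadic))) ∧
    (∀ p : PeriodDoubling.Word,
      ¬ ((PeriodDoubling.IsRegular p ∨ PeriodDoubling.IsRegular (PeriodDoubling.complement p)) ∧
          (p ∈ PeriodDoubling.sporadic ∨
            PeriodDoubling.complement p ∈ PeriodDoubling.sporadic))) := by
  refine ⟨fun p => ⟨?_, ?_⟩, ?_⟩
  · rintro ⟨g, hg, h⟩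
    exact PeriodDoubling.isClassified_of_occurs hg ((PeriodDoubling.isFactor_iff_occurs _).1 h)
  · rintro ((h | h) | (h | h))
    · exact h.encounters
    · exact .of_complement h.encounters
    · exact PeriodDoubling.encounters_of_mem_sporadic h
    · exact .of_complement (PeriodDoubling.encounters_of_mem_sporadic h)
  · rintro p ⟨h | h, hs⟩
    · exact PeriodDoubling.not_isRegular_of_mem_sporadic hs h
    · refine PeriodDoubling.not_isRegular_of_mem_sporadic ?_ h
      rw [PeriodDoubling.complement_complement]
      exact hs.symm
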